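/- Let $\mathcal N$ be a finite irreducible abelian network that halts on all inputs. The terms mean the following. **Network.** Let $G=(V,E)$ be a finite directed graph (loops allowed), with a finite alphabet $A_v$ and a finite state space $Q_v$ at each vertex; put $A=\bigsqcup_v A_v$ and $Q=\prod_v Q_v$. At each $v$ there is an abelian processor: commuting maps $t_a:Q_v\to Q_v$ $(a\in A_v)$ and message functions $o_a^u:Q_v\to A_u^*$ for $a\in A_v$, $(v,u)\in E$, such that two input words that are equal up to permutation, read from the same state, produce on each edge output words that are equal up to permutation. $\mathcal N$ is *irreducible* if for each $v$ the set $Q_v$ is nonempty and for all $p,p'\in Q_v$ there are $m,m'$ in the local monoid $M_v=\langle t_a\rangle_{a\in A_v}\subset \mathrm{End}(Q_v)$ with $mp=m'p'$. **Executions.** For $\mathbf x\in\mathbb Z^A$ and $\mathbf q\in Q$, processing a letter $a\in A_v$ from $\mathbf x.\mathbf q$ lowers $\mathbf x_a$ by one, replaces $\mathbf q_v$ by $t_a(\mathbf q_v)$, and adds to $\mathbf x$ the letters of the messages $o_a^u(\mathbf q_v)$ over all edges $(v,u)$. A word is *legal* for $\mathbf x.\mathbf q$ if each of its letters $a$ is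 processed when the current $a$-coordinate is at least $1$, and *complete* if the final vector is $\le\mathbf 0$. $\mathcal N$ *halts on all inputs* if every $\mathbf x.\mathbf q$ with $\mathbf x\in\mathbb N^A$, $\mathbf q\in Q$ has a complete legal execution. The final state, which does not depend on that execution, is written $\mathbf x\triangleright\!\triangleright\mathbf q$. **Critical group.** The *minimal idempotent* of a finite commutative monoid is the product of all its idempotents. Let $\tau_a(\mathbf q)=1_a\triangleright\!\triangleright\mathbf q$, let $M=\langle\tau_a\rangle_{a\in A}\subset\mathrm{End}(Q)$, a finite commutative monoid, and let $e$ be its minimal idempotent. The *critical group* is the abelian group $\mathrm{Crit}\,\mathcal N=eM$ with identity $e$. The *natural map* $\mathbb Z^A\to\mathrm{Crit}\,\mathcal N$ is the group homomorphism with $1_a\mapsto e\tau_a$. **Laplacian.** Let $e_v$ be the minimal idempotent of $M_v$. The maps $t_a$ $(a\in A_v)$ permute $e_vQ_v$, so $\mathbb Z^{A_v}$ acts on $e_vQ_v$; let $K_v$ be the kernel of this action and $K=\prod_vK_v\subset\mathbb Z^A$, a subgroup of finite index. A state $\mathbf q$ is *locally recurrent* if $\mathbf q_v\in e_vQ_v$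 for all $v$. For such $\mathbf q$ the *production map* $P:K\to\mathbb Z^A$ is the group homomorphism such that for $\mathbf k\in K\cap\mathbb N^A$, processing exactly the letters $\mathbf k$ from $\mathbf k.\mathbf q$ results in $P(\mathbf k).\mathbf q$; it does not depend on the choice of $\mathbf q$. Write $P$ also for the $A\times A$ rational matrix of its $\mathbb Q$-linear extension. Let $r_a=\min\{m\ge1: m1_a\in K\}$, let $D$ be the diagonal matrix with entries $r_a$, and let $L=(I-P)D$, which maps $\mathbb Z^A$ into $\mathbb Z^A$. $\mathcal N$ is *rectangular* if $K=\prod_{a\in A}r_a\mathbb Z$. **Statement.** The natural map $\mathbb Z^A\to\mathrm{Crit}\,\mathcal N$ induces a surjective group homomorphism $$\phi:\mathbb Z^A/L\mathbb Z^A\twoheadrightarrow\mathrm{Crit}\,\mathcal N .$$ If $\mathcal N$ is rectangular, then $\phi$ is an isomorphism. -/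

import Mathlib

set_option linter.unusedSectionVars false

namespace AbelianNet

/-! ### Finite commutative monoids and their actions -/

section Monoids

/-- The minimal idempotent of a finite commutative monoid: the product of all its idempotents. -/
noncomputable def minIdempotent (M : Type*) [CommMonoid M] [Finite M] : M :=
  ∏ f ∈ (Set.toFinite {f : M | f * f = f}).toFinset, f

theorem minIdempotent_mul_self (M : Type*) [CommMonoid M] [Finite M] :
    minIdempotent M * minIdempotent M = minIdempotent M := by
  unfold minIdempotent
  rw [← Finset.prod_mul_distrib]
  refine Finset.prod_congr rfl fun f hf => ?_
  simpa using hf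

theorem exists_idempotent_pow {M : Type*} [CommMonoid M] [Finite M] (m : M) :
    ∃ j : ℕ, 1 ≤ j ∧ m ^ j * m ^ j = m ^ j := by
  obtain ⟨a, b, hab, h⟩ : ∃ a b : ℕ, a < b ∧ m ^ a = m ^ b := by
    obtain ⟨a, b, hne, h⟩ := Finite.exists_ne_map_eq_of_infinite (fun n : ℕ => m ^ n)
    rcases lt_or_gt_of_ne hne with hlt | hlt
    · exact ⟨a, b, hlt, h⟩
    · exact ⟨b, a, hlt, h.symm⟩
  obtain ⟨d, rfl⟩ := Nat.exists_eq_add_of_lt hab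
  have hper : ∀ k n : ℕ, a ≤ n → m ^ (n + k * (d + 1)) = m ^ n := by
    intro k
    induction k with
    | zero => intro n _; simp
    | succ k ih =>
      intro n hn
      have h1 : n + (k + 1) * (d + 1) = (n + (d + 1)) + k * (d + 1) := by ring
      rw [h1, ih (n + (d + 1)) (by omega)]
      obtain ⟨c, rfl⟩ := Nat.exists_eq_add_of_le hn
      have h2 : a + c + (d + 1) = (a + d + 1) + c := by ring
      rw [h2, pow_add, ← h, ← pow_add]
  refine ⟨(a + 1) * (d + 1), ?_, ?_⟩
  · exact Nat.succ_le_of_lt (Nat.mul_pos (Nat.succ_pos _) (Nat.succ_pos _))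
  · rw [← pow_add]
    exact hper (a + 1) ((a + 1) * (d + 1)) (by nlinarith)

/-- The minimal idempotent is accessible from every element. -/
theorem exists_mul_eq_minIdempotent {M : Type*} [CommMonoid M] [Finite M] (m : M) :
    ∃ m' : M, m * m' = minIdempotent M := by
  obtain ⟨j, hj, h⟩ := exists_idempotent_pow m
  have hd : m ^ j ∣ minIdempotent M :=
    Finset.dvd_prod_of_mem (fun f : M => f) (by simpa using h)
  have hm : m ∣ m ^ j := dvd_pow_self m (by omega)
  obtain ⟨c, hc⟩ := hm.trans hd
  exact ⟨c, hc.symm⟩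

/-- The subset `eM` of a finite commutative monoid `M` with minimal idempotent `e`. -/
def MinGroup (M : Type*) [CommMonoid M] [Finite M] : Type _ :=
  {x : M // ∃ m : M, x = minIdempotent M * m}

theorem MinGroup.minIdempotent_mul {M : Type*} [CommMonoid M] [Finite M] (g : MinGroup M) :
    minIdempotent M * g.1 = g.1 := by
  obtain ⟨x, m, rfl⟩ := g
  simp only
  rw [← mul_assoc, minIdempotent_mul_self]

theorem MinGroup.exists_inv {M : Type*} [CommMonoid M] [Finite M] (g : MinGroup M) :
    ∃ h : MinGroup M, h.1 * g.1 = minIdempotent M := by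
  obtain ⟨c, hc⟩ := exists_mul_eq_minIdempotent g.1
  refine ⟨⟨minIdempotent M * c, c, rfl⟩, ?_⟩
  simp only
  rw [mul_assoc, mul_comm c, hc, minIdempotent_mul_self]

/-- `eM` is an abelian group under the multiplication of `M`, with identity element `e`. -/
noncomputable instance (M : Type*) [CommMonoid M] [Finite M] : CommGroup (MinGroup M) where
  mul g h := ⟨g.1 * h.1, g.1 * h.1, by
    rw [← mul_assoc, MinGroup.minIdempotent_mul]⟩
  one := ⟨minIdempotent M, 1, by rw [mul_one]⟩
  inv g := Classical.choose g.exists_inv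
  mul_assoc g h k := Subtype.ext (mul_assoc g.1 h.1 k.1)
  one_mul g := Subtype.ext g.minIdempotent_mul
  mul_one g := Subtype.ext ((mul_comm _ _).trans g.minIdempotent_mul)
  mul_comm g h := Subtype.ext (mul_comm g.1 h.1)
  inv_mul_cancel g := Subtype.ext (Classical.choose_spec g.exists_inv)

instance (M : Type*) [CommMonoid M] [Finite M] : Finite (MinGroup M) :=
  inferInstanceAs (Finite {x : M // ∃ m : M, x = minIdempotent M * m})

/-- The map `M → eM`, `m ↦ e m`. -/
noncomputable def toMinGroup {M : Type*} [CommMonoid M] [Finite M] (m : M) : MinGroup M :=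
  ⟨minIdempotent M * m, m, rfl⟩

/-- Given a family `(g a)` in `M`, the group homomorphism `ℤ^I → eM` with `1_a ↦ e (g a)`. -/
noncomputable def naturalMap {M : Type*} [CommMonoid M] [Finite M] {I : Type*} [Fintype I]
    (g : I → M) : (I → ℤ) →+ Additive (MinGroup M) where
  toFun x := ∑ a, x a • Additive.ofMul (toMinGroup (g a))
  map_zero' := by simp
  map_add' x y := by simp [add_smul, Finset.sum_add_distrib]

theorem naturalMap_single {M : Type*} [CommMonoid M] [Finite M] {I : Type*} [Fintype I]
    [DecidableEq I] (g : I → M) (a : I) :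
    naturalMap g (Pi.single a 1) = Additive.ofMul (toMinGroup (g a)) := by
  change ∑ b, (Pi.single a 1 : I → ℤ) b • Additive.ofMul (toMinGroup (g b)) = _
  rw [Finset.sum_eq_single a]
  · simp
  · intro b _ hb
    simp [hb]
  · simp

/-- An action is irreducible if the relation `x ∼ x'` given by `m x = m' x'` for some `m, m'`
has exactly one class. -/
def IsIrreducibleAction (M X : Type*) [Monoid M] [MulAction M X] : Prop :=
  Nonempty X ∧ ∀ x x' : X, ∃ m m' : M, m • x = m' • x'

/-- The set `eX` of recurrent elements. -/
def recurrentSet (M X : Type*) [CommMonoid M] [Finite M] [MulAction M X] : Set X :=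
  Set.range fun x : X => minIdempotent M • x

theorem minIdempotent_smul {M X : Type*} [CommMonoid M] [Finite M] [MulAction M X] {x : X}
    (hx : x ∈ recurrentSet M X) : minIdempotent M • x = x := by
  obtain ⟨y, rfl⟩ := hx
  simp only
  rw [← mul_smul, minIdempotent_mul_self]

/-- The restriction of an action `M × X → X` to a group action `eM × eX → eX`. -/
noncomputable instance (M X : Type*) [CommMonoid M] [Finite M] [MulAction M X] :
    MulAction (MinGroup M) (recurrentSet M X) where
  smul g x := ⟨g.1 • x.1, g.1 • x.1, by
    change minIdempotent M • (g.1 • x.1) = g.1 • x.1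
    rw [← mul_smul, g.minIdempotent_mul]⟩
  one_smul x := Subtype.ext (minIdempotent_smul x.2)
  mul_smul g h x := Subtype.ext (mul_smul g.1 h.1 x.1)

theorem toMinGroup_smul {M X : Type*} [CommMonoid M] [Finite M] [MulAction M X] (m : M)
    (x : recurrentSet M X) : (toMinGroup m • x).1 = m • x.1 := by
  change (minIdempotent M * m) • x.1 = _
  rw [mul_comm, mul_smul, minIdempotent_smul x.2]

end Monoids

/-! ### Abelian processors -/

section Processors

/-- The word output on feed `u` when the input word is read starting from state `q`. -/
def outputWord {I Q U : Type*} {B : U → Type*} (t : I → Function.End Q)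
    (o : I → (u : U) → Q → List (B u)) (u : U) : List I → Q → List (B u)
  | [], _ => []
  | a :: w, q => o a u q ++ outputWord t o u w (t a q)

/-- An abelian processor with input alphabet `I`, state space `Q` and output alphabets
`(B u)`, `u : U`. -/
structure Processor (I Q : Type*) {U : Type*} (B : U → Type*) where
  /-- state transitions -/
  t : I → Function.End Q
  /-- message passing -/
  o : I → (u : U) → Q → List (B u)
  t_comm : ∀ a b : I, t a * t b = t b * t a
  out_perm : ∀ w w' : List I, w.Perm w' → ∀ (q : Q) (u : U),
    (outputWord t o u w q).Perm (outputWord t o u w' q)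

variable {I Q U : Type*} {B : U → Type*}

/-- The transition monoid, generated by the transition maps inside `End Q`. -/
def Processor.monoid (p : Processor I Q B) : Submonoid (Function.End Q) :=
  Submonoid.closure (Set.range p.t)

theorem mul_comm_of_closure {N : Type*} [Monoid N] {s : Set N}
    (h : ∀ a ∈ s, ∀ b ∈ s, a * b = b * a) (x y : Submonoid.closure s) : x * y = y * x :=
  (Submonoid.isMulCommutative_closure N h).is_comm.comm x y

instance (p : Processor I Q B) : CommMonoid p.monoid :=
  { (inferInstance : Monoid p.monoid) with
    mul_comm := mul_comm_of_closure (by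
      rintro _ ⟨a, rfl⟩ _ ⟨b, rfl⟩
      exact p.t_comm a b) }

instance [Finite Q] : Finite (Function.End Q) := inferInstanceAs (Finite (Q → Q))

/-- The transition maps as elements of the transition monoid. -/
def Processor.gen (p : Processor I Q B) (a : I) : p.monoid :=
  ⟨p.t a, Submonoid.subset_closure ⟨a, rfl⟩⟩

/-- A processor is irreducible if its transition monoid acts irreducibly on its states. -/
def Processor.IsIrreducible (p : Processor I Q B) : Prop :=
  IsIrreducibleAction p.monoid Q

/-- The set `e Q` of recurrent states of a processor. -/
def Processor.recurrent [Finite Q] (p : Processor I Q B) : Set Q :=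
  recurrentSet p.monoid Q

/-- The action of `ℤ^I` on `e Q`, in which `1_a` acts by `t_a`. -/
noncomputable def Processor.intAction [Fintype I] [Finite Q] (p : Processor I Q B) :
    (I → ℤ) →+ Additive (Equiv.Perm (recurrentSet p.monoid Q)) :=
  (MonoidHom.toAdditive (MulAction.toPermHom (MinGroup p.monoid) (recurrentSet p.monoid Q))).comp
    (naturalMap p.gen)

/-- The kernel of the action of `ℤ^I` on `e Q`. -/
noncomputable def Processor.kernel [Fintype I] [Finite Q] (p : Processor I Q B) :
    AddSubgroup (I → ℤ) :=
  p.intAction.ker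

theorem Processor.intAction_single [Fintype I] [DecidableEq I] [Finite Q] (p : Processor I Q B)
    (a : I) (q : recurrentSet p.monoid Q) :
    ((p.intAction (Pi.single a 1)).toMul q).1 = p.t a q.1 := by
  unfold Processor.intAction
  rw [AddMonoidHom.comp_apply, naturalMap_single]
  exact toMinGroup_smul (p.gen a) q

theorem Processor.exists_smul_mem_kernel [Fintype I] [Finite Q] (p : Processor I Q B) :
    ∃ n : ℕ, 0 < n ∧ ∀ x : I → ℤ, n • x ∈ p.kernel := by
  refine ⟨Nat.card (MinGroup p.monoid), Nat.card_pos, fun x => ?_⟩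
  have h : Nat.card (MinGroup p.monoid) • naturalMap p.gen x = 0 :=
    pow_card_eq_one' (G := MinGroup p.monoid) (x := (naturalMap p.gen x).toMul)
  unfold Processor.kernel Processor.intAction
  rw [AddMonoidHom.mem_ker, AddMonoidHom.comp_apply, map_nsmul, h, map_zero]

end Processors
/-! ### Abelian networks -/

/-- An abelian network on the directed graph `G` with alphabets `A v` and state spaces `Q v`:
an abelian processor at each vertex, with one output feed for each outgoing edge. -/
structure Network {V : Type*} (G : Digraph V) (A Q : V → Type*) where
  proc : (v : V) → Processor (A v) (Q v) (fun u : {u : V // G.Adj v u} => A u.1)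

namespace Network

section Executions

variable {V : Type*} [DecidableEq V] {G : Digraph V} {A Q : V → Type*} [∀ v, DecidableEq (A v)]

/-- The letters passed when letter `a` is processed at `v` in state `q`, counted by type. -/
noncomputable def message (N : Network G A Q) (v : V) (a : A v) (q : Q v) : (Σ v, A v) → ℕ :=
  open Classical in fun b =>
    if h : G.Adj v b.1 then ((N.proc v).o a ⟨b.1, h⟩ q).count b.2 else 0

/-- Process one letter `a`: remove it from the vector of waiting letters (possibly incurring a
debt), add the letters that are passed, and change the state of the processor reading it. -/
noncomputable def step (N : Network G A Q) (a : Σ v, A v)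
    (s : ((Σ v, A v) → ℤ) × ((v : V) → Q v)) : ((Σ v, A v) → ℤ) × ((v : V) → Q v) :=
  (fun b => s.1 b - (Pi.single a 1 : (Σ v, A v) → ℤ) b + (N.message a.1 a.2 (s.2 a.1) b : ℤ),
    Function.update s.2 a.1 ((N.proc a.1).t a.2 (s.2 a.1)))

/-- The result `π_w(x.q)` of executing the word `w` from `x.q`. -/
noncomputable def exec (N : Network G A Q) (w : List (Σ v, A v))
    (s : ((Σ v, A v) → ℤ) × ((v : V) → Q v)) : ((Σ v, A v) → ℤ) × ((v : V) → Q v) :=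
  w.foldl (fun s a => N.step a s) s

/-- `w` is legal for `s` if each letter is present when it is processed. -/
def Legal (N : Network G A Q) :
    List (Σ v, A v) → ((Σ v, A v) → ℤ) × ((v : V) → Q v) → Prop
  | [], _ => True
  | a :: w, s => 1 ≤ s.1 a ∧ N.Legal w (N.step a s)

/-- `w` is complete for `s` if it leaves no letters. -/
def Complete (N : Network G A Q) (w : List (Σ v, A v))
    (s : ((Σ v, A v) → ℤ) × ((v : V) → Q v)) : Prop :=
  ∀ a, (N.exec w s).1 a ≤ 0

/-- `N` halts on all inputs: every `x.q` with `x ∈ ℕ^A` has a complete legal execution. -/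
def HaltsOnAllInputs (N : Network G A Q) : Prop :=
  ∀ (x : (Σ v, A v) → ℕ) (q : (v : V) → Q v), ∃ w : List (Σ v, A v),
    N.Legal w (fun a => (x a : ℤ), q) ∧ N.Complete w (fun a => (x a : ℤ), q)

variable (N : Network G A Q)

theorem message_comm (v : V) (a b : A v) (q : Q v) (c : Σ v, A v) :
    N.message v a q c + N.message v b ((N.proc v).t a q) c =
      N.message v b q c + N.message v a ((N.proc v).t b q) c := by
  unfold message
  split_ifs with h
  · have := ((N.proc v).out_perm [a, b] [b, a] (List.Perm.swap b a []) q ⟨c.1, h⟩).count_eq c.2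
    simpa [outputWord, List.count_append] using this
  · rfl

theorem step_comm (a b : Σ v, A v) (s : ((Σ v, A v) → ℤ) × ((v : V) → Q v)) :
    N.step a (N.step b s) = N.step b (N.step a s) := by
  obtain ⟨v, a⟩ := a
  obtain ⟨u, b⟩ := b
  obtain ⟨x, q⟩ := s
  by_cases huv : u = v
  · subst huv
    refine Prod.ext ?_ ?_
    · funext c
      have h := N.message_comm u a b (q u) c
      simp only [step, Function.update_self]
      have h' : (N.message u a (q u) c : ℤ) + N.message u b ((N.proc u).t a (q u)) c =
        N.message u b (q u) c + N.message u a ((N.proc u).t b (q u)) c := by exact_mod_cast h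
      linarith
    · simp only [step, Function.update_self, Function.update_idem]
      congr 1
      exact congrFun ((N.proc u).t_comm a b) (q u)
  · have hvu : v ≠ u := fun h => huv h.symm
    refine Prod.ext ?_ ?_
    · funext c
      simp only [step, Function.update_of_ne huv, Function.update_of_ne hvu]
      ring
    · simp only [step, Function.update_of_ne huv, Function.update_of_ne hvu]
      exact Function.update_comm huv _ _ _

/-- The result of an execution does not depend on the order of the letters. -/
theorem exec_perm {w w' : List (Σ v, A v)} (h : w.Perm w')
    (s : ((Σ v, A v) → ℤ) × ((v : V) → Q v)) : N.exec w s = N.exec w' s := by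
  unfold exec
  exact h.foldl_eq' (fun a _ b _ z => N.step_comm b a z) s

theorem exec_append (w w' : List (Σ v, A v)) (s : ((Σ v, A v) → ℤ) × ((v : V) → Q v)) :
    N.exec (w ++ w') s = N.exec w' (N.exec w s) := by
  simp [exec, List.foldl_append]

theorem exec_cons (a : Σ v, A v) (w : List (Σ v, A v))
    (s : ((Σ v, A v) → ℤ) × ((v : V) → Q v)) : N.exec (a :: w) s = N.exec w (N.step a s) := rfl

theorem step_add (a : Σ v, A v) (x y : (Σ v, A v) → ℤ) (q : (v : V) → Q v) :
    N.step a (x + y, q) = ((N.step a (x, q)).1 + y, (N.step a (x, q)).2) := by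
  refine Prod.ext ?_ rfl
  funext b
  simp only [step, Pi.add_apply]
  ring

theorem exec_add (w : List (Σ v, A v)) (x y : (Σ v, A v) → ℤ) (q : (v : V) → Q v) :
    N.exec w (x + y, q) = ((N.exec w (x, q)).1 + y, (N.exec w (x, q)).2) := by
  induction w generalizing x q with
  | nil => rfl
  | cons a w ih => rw [exec_cons, exec_cons, step_add, ih]

theorem legal_append (w w' : List (Σ v, A v)) (s : ((Σ v, A v) → ℤ) × ((v : V) → Q v))
    (h : N.Legal w s) (h' : N.Legal w' (N.exec w s)) : N.Legal (w ++ w') s := by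
  induction w generalizing s with
  | nil => exact h'
  | cons a w ih => exact ⟨h.1, ih _ h.2 h'⟩

theorem legal_add (w : List (Σ v, A v)) (x y : (Σ v, A v) → ℤ) (q : (v : V) → Q v)
    (hy : ∀ a, 0 ≤ y a) (h : N.Legal w (x, q)) : N.Legal w (x + y, q) := by
  induction w generalizing x q with
  | nil => trivial
  | cons a w ih =>
    refine ⟨?_, ?_⟩
    · have h1 := h.1
      have h2 := hy a
      simp only [Pi.add_apply] at h1 ⊢
      linarith
    · rw [step_add]
      exact ih _ _ h.2

theorem step_fst_le {a b : Σ v, A v} (hab : b ≠ a) (s : ((Σ v, A v) → ℤ) × ((v : V) → Q v)) :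
    s.1 b ≤ (N.step a s).1 b := by
  simp only [step, Pi.single_eq_of_ne hab]
  have : (0 : ℤ) ≤ N.message a.1 a.2 (s.2 a.1) b := Int.natCast_nonneg _
  linarith

theorem exec_nonneg (w : List (Σ v, A v)) (s : ((Σ v, A v) → ℤ) × ((v : V) → Q v))
    (hs : ∀ a, 0 ≤ s.1 a) (h : N.Legal w s) (b : Σ v, A v) : 0 ≤ (N.exec w s).1 b := by
  induction w generalizing s with
  | nil => exact hs b
  | cons a w ih =>
    refine ih (N.step a s) (fun c => ?_) h.2
    by_cases hc : c = a
    · subst hc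
      have h1 := h.1
      simp only [step, Pi.single_eq_same]
      have : (0 : ℤ) ≤ N.message c.1 c.2 (s.2 c.1) c := Int.natCast_nonneg _
      linarith
    · exact (hs c).trans (N.step_fst_le hc s)

theorem exists_perm_cons (w : List (Σ v, A v)) (s : ((Σ v, A v) → ℤ) × ((v : V) → Q v))
    (a : Σ v, A v) (ha : 1 ≤ s.1 a) (h : N.Legal w s) (hc : N.Complete w s) :
    ∃ w', w.Perm (a :: w') ∧ N.Legal w' (N.step a s) := by
  induction w generalizing s with
  | nil =>
    have := hc a
    simp only [exec, List.foldl_nil] at this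
    omega
  | cons b w ih =>
    by_cases hab : a = b
    · subst hab
      exact ⟨w, List.Perm.refl _, h.2⟩
    · obtain ⟨w', hp, hl⟩ := ih (N.step b s) (ha.trans (N.step_fst_le hab s)) h.2 hc
      refine ⟨b :: w', (hp.cons b).trans (List.Perm.swap a b w'), ?_, ?_⟩
      · exact h.1.trans (N.step_fst_le (Ne.symm hab) s)
      · rw [step_comm]
        exact hl

/-- Any two complete legal executions agree up to the order of the letters. -/
theorem perm_of_legal_complete (w w' : List (Σ v, A v))
    (s : ((Σ v, A v) → ℤ) × ((v : V) → Q v)) (h : N.Legal w s) (hc : N.Complete w s)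
    (h' : N.Legal w' s) (hc' : N.Complete w' s) : w.Perm w' := by
  induction w generalizing s w' with
  | nil =>
    cases w' with
    | nil => exact List.Perm.refl _
    | cons b w' =>
      have h1 := hc b
      have h2 := h'.1
      simp only [exec, List.foldl_nil] at h1
      omega
  | cons a w ih =>
    obtain ⟨u, hp, hl⟩ := N.exists_perm_cons w' s a h.1 h' hc'
    have hu : N.Complete u (N.step a s) := by
      intro b
      rw [← exec_cons, ← N.exec_perm hp]
      exact hc' b
    exact ((ih u _ h.2 hc hl hu).cons a).trans hp.symm

/-! ### The global action and the critical group -/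

variable {N}

/-- The final state `x ▷▷ q` of a complete legal execution for `x.q`. -/
noncomputable def globalAct (hN : N.HaltsOnAllInputs) (x : (Σ v, A v) → ℕ)
    (q : (v : V) → Q v) : (v : V) → Q v :=
  (N.exec (Classical.choose (hN x q)) (fun a => (x a : ℤ), q)).2

/-- `x ▷▷ q` does not depend on the choice of the complete legal execution. -/
theorem globalAct_eq (hN : N.HaltsOnAllInputs) (x : (Σ v, A v) → ℕ) (q : (v : V) → Q v)
    (w : List (Σ v, A v)) (h : N.Legal w (fun a => (x a : ℤ), q))
    (hc : N.Complete w (fun a => (x a : ℤ), q)) :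
    globalAct hN x q = (N.exec w (fun a => (x a : ℤ), q)).2 := by
  have hs := Classical.choose_spec (hN x q)
  unfold globalAct
  rw [N.exec_perm (N.perm_of_legal_complete _ w _ hs.1 hs.2 h hc)]

theorem globalAct_add (hN : N.HaltsOnAllInputs) (x y : (Σ v, A v) → ℕ) (q : (v : V) → Q v) :
    globalAct hN (x + y) q = globalAct hN y (globalAct hN x q) := by
  obtain ⟨w, hw, hwc⟩ := hN x q
  have hx := globalAct_eq hN x q w hw hwc
  obtain ⟨u, hu, huc⟩ := hN y (globalAct hN x q)
  have hy := globalAct_eq hN y (globalAct hN x q) u hu huc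
  have hxy : (fun a => (((x + y) a : ℕ) : ℤ)) =
      (fun a => (x a : ℤ)) + fun a => (y a : ℤ) := by
    funext a
    simp
  have he : N.exec w (fun a => (((x + y) a : ℕ) : ℤ), q) =
      (fun a => (y a : ℤ), globalAct hN x q) := by
    rw [hxy, exec_add]
    refine Prod.ext ?_ hx.symm
    funext a
    have h1 := hwc a
    have h2 := N.exec_nonneg w (fun a => (x a : ℤ), q) (fun a => Int.natCast_nonneg _) hw a
    simp only [Pi.add_apply]
    omega
  rw [hy, ← he, ← exec_append]
  refine globalAct_eq hN (x + y) q (w ++ u) ?_ ?_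
  · refine N.legal_append _ _ _ ?_ (by rw [he]; exact hu)
    rw [hxy]
    exact N.legal_add _ _ _ _ (fun a => Int.natCast_nonneg _) hw
  · intro a
    rw [exec_append, he]
    exact huc a

/-- The map `τ_a`, `q ↦ 1_a ▷▷ q`. -/
noncomputable def tau (hN : N.HaltsOnAllInputs) (a : Σ v, A v) : Function.End ((v : V) → Q v) :=
  fun q => globalAct hN (Pi.single a 1) q

/-- The global monoid, generated by the maps `τ_a` inside `End Q`. -/
def globalMonoid (hN : N.HaltsOnAllInputs) : Submonoid (Function.End ((v : V) → Q v)) :=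
  Submonoid.closure (Set.range (tau hN))

noncomputable instance (hN : N.HaltsOnAllInputs) : CommMonoid (globalMonoid hN) :=
  { (inferInstance : Monoid (globalMonoid hN)) with
    mul_comm := mul_comm_of_closure (by
      rintro _ ⟨a, rfl⟩ _ ⟨b, rfl⟩
      funext q
      change globalAct hN _ (globalAct hN _ q) = globalAct hN _ (globalAct hN _ q)
      rw [← globalAct_add, ← globalAct_add, add_comm]) }

variable [Fintype V] [∀ v, Fintype (A v)] [∀ v, Finite (Q v)]

/-- The critical group `e M`, where `M` is the global monoid and `e` its minimal idempotent. -/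
abbrev Crit (hN : N.HaltsOnAllInputs) : Type _ := MinGroup (globalMonoid hN)

/-- The natural map `ℤ^A → Crit N`, sending `1_a` to `e τ_a`. -/
noncomputable def toCrit (hN : N.HaltsOnAllInputs) :
    ((Σ v, A v) → ℤ) →+ Additive (Crit hN) :=
  naturalMap fun a => (⟨tau hN a, Submonoid.subset_closure ⟨a, rfl⟩⟩ : globalMonoid hN)

end Executions

/-! ### Total kernel, production map and Laplacian -/

section Laplacian

variable {V : Type*} [Fintype V] [DecidableEq V] {G : Digraph V} {A Q : V → Type*}
  [∀ v, Fintype (A v)] [∀ v, DecidableEq (A v)] [∀ v, Finite (Q v)] (N : Network G A Q)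

/-- A network is irreducible if each of its processors is. -/
def IsIrreducible : Prop := ∀ v, (N.proc v).IsIrreducible

/-- The total kernel `K = ∏ K_v`. -/
noncomputable def totalKernel : AddSubgroup ((Σ v, A v) → ℤ) where
  carrier := {x | ∀ v, (fun a => x ⟨v, a⟩) ∈ (N.proc v).kernel}
  zero_mem' := fun v => (N.proc v).kernel.zero_mem
  add_mem' := fun hx hy v => (N.proc v).kernel.add_mem (hx v) (hy v)
  neg_mem' := fun hx v => (N.proc v).kernel.neg_mem (hx v)

/-- The locally recurrent states: `q v ∈ e_v Q_v` for all `v`. -/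
def locallyRecurrent : Set ((v : V) → Q v) := {q | ∀ v, q v ∈ (N.proc v).recurrent}

theorem exists_smul_mem_totalKernel :
    ∃ n : ℕ, 0 < n ∧ ∀ x : (Σ v, A v) → ℤ, n • x ∈ N.totalKernel := by
  choose n hn h using fun v => (N.proc v).exists_smul_mem_kernel
  refine ⟨∏ v, n v, Finset.prod_pos fun v _ => hn v, fun x v => ?_⟩
  obtain ⟨c, hc⟩ := Finset.dvd_prod_of_mem n (Finset.mem_univ v)
  rw [hc]
  have := h v (c • fun a => x ⟨v, a⟩)
  rwa [← mul_smul] at this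

/-- An irreducible network has locally recurrent states. -/
theorem locallyRecurrent_nonempty (h : N.IsIrreducible) : N.locallyRecurrent.Nonempty :=
  ⟨fun v => minIdempotent (N.proc v).monoid • (h v).1.some, fun v => ⟨(h v).1.some, rfl⟩⟩

/-- A word containing each letter `a` exactly `k a` times. -/
noncomputable def wordOf (k : (Σ v, A v) → ℕ) : List (Σ v, A v) :=
  Finset.univ.toList.flatMap fun a => List.replicate (k a) a

theorem count_wordOf (k : (Σ v, A v) → ℕ) (a : Σ v, A v) : (wordOf k).count a = k a := by
  unfold wordOf
  rw [List.count_flatMap, Finset.sum_map_toList]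
  simp [List.count_replicate]

/-- The local action `k ▷ q`: the result of adding the letters `k` to `0.q` and processing
exactly these letters. -/
noncomputable def localAct (k : (Σ v, A v) → ℕ) (q : (v : V) → Q v) :
    ((Σ v, A v) → ℤ) × ((v : V) → Q v) :=
  N.exec (wordOf k) (fun a => (k a : ℤ), q)

variable {N}

theorem exec_snd (w : List (Σ v, A v)) (x : (Σ v, A v) → ℤ) (q : (v : V) → Q v)
    (hq : q ∈ N.locallyRecurrent) (v : V) :
    (N.exec w (x, q)).2 v =
      (((N.proc v).intAction (fun a => (w.count ⟨v, a⟩ : ℤ))).toMul ⟨q v, hq v⟩).1 := by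
  induction w generalizing x q with
  | nil =>
    have h0 : (fun a : A v => ((([] : List (Σ v, A v)).count ⟨v, a⟩ : ℕ) : ℤ)) = 0 := by
      funext a
      simp
    rw [h0, map_zero]
    rfl
  | cons b w ih =>
    obtain ⟨u, b⟩ := b
    have hstep : ∀ v', (N.step ⟨u, b⟩ (x, q)).2 v' ∈ (N.proc v').recurrent ∧
        (N.step ⟨u, b⟩ (x, q)).2 v' =
          (((N.proc v').intAction (fun a => (([⟨u, b⟩] : List (Σ v, A v)).count ⟨v', a⟩ : ℤ))).toMul
            ⟨q v', hq v'⟩).1 := by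
      intro v'
      have key : (N.step ⟨u, b⟩ (x, q)).2 v' =
          (((N.proc v').intAction (fun a => (([⟨u, b⟩] : List (Σ v, A v)).count ⟨v', a⟩ : ℤ))).toMul
            ⟨q v', hq v'⟩).1 := by
        by_cases hv : v' = u
        · subst hv
          have h1 : (fun a => (([⟨v', b⟩] : List (Σ v, A v)).count ⟨v', a⟩ : ℤ)) =
              Pi.single b 1 := by
            funext a
            by_cases hab : a = b
            · subst hab
              simp
            · simp [hab, Ne.symm hab]
          rw [h1, Processor.intAction_single]
          simp [step]
        · have h1 : (fun a => (([⟨u, b⟩] : List (Σ v, A v)).count ⟨v', a⟩ : ℤ)) = 0 := by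
            funext a
            have : ¬ (u = v') := fun h => hv h.symm
            simp [this]
          rw [h1, map_zero]
          simp [step, Function.update_of_ne hv]
      refine ⟨?_, key⟩
      rw [key]
      exact Subtype.prop _
    have hsplit : (fun a => (((⟨u, b⟩ :: w : List (Σ v, A v)).count ⟨v, a⟩ : ℕ) : ℤ)) =
        (fun a => ((w.count ⟨v, a⟩ : ℕ) : ℤ)) +
          fun a => (([⟨u, b⟩] : List (Σ v, A v)).count ⟨v, a⟩ : ℤ) := by
      funext a
      simp [List.count_cons]
    rw [exec_cons, hsplit, map_add]
    have := ih (N.step ⟨u, b⟩ (x, q)).1 (N.step ⟨u, b⟩ (x, q)).2 (fun v' => (hstep v').1)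
    rw [Prod.mk.eta] at this
    rw [this]
    have he : (⟨(N.step ⟨u, b⟩ (x, q)).2 v, (hstep v).1⟩ : recurrentSet (N.proc v).monoid (Q v)) =
        ((N.proc v).intAction
          (fun a => (([⟨u, b⟩] : List (Σ v, A v)).count ⟨v, a⟩ : ℤ))).toMul ⟨q v, hq v⟩ :=
      Subtype.ext (hstep v).2
    rw [he]
    rfl

/-- Letters in `K ∩ ℕ^A` return each locally recurrent state to itself. -/
theorem localAct_snd {q : (v : V) → Q v} (hq : q ∈ N.locallyRecurrent) {k : (Σ v, A v) → ℕ}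
    (hk : (fun a => (k a : ℤ)) ∈ N.totalKernel) : (N.localAct k q).2 = q := by
  funext v
  unfold localAct
  rw [exec_snd _ _ _ hq]
  simp only [count_wordOf]
  have h := hk v
  rw [Processor.kernel, AddMonoidHom.mem_ker] at h
  rw [h]
  rfl

theorem localAct_add {q : (v : V) → Q v} (hq : q ∈ N.locallyRecurrent) {k l : (Σ v, A v) → ℕ}
    (hk : (fun a => (k a : ℤ)) ∈ N.totalKernel) :
    (N.localAct (k + l) q).1 = (N.localAct k q).1 + (N.localAct l q).1 := by
  have hp : (wordOf (k + l)).Perm (wordOf k ++ wordOf l) := by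
    rw [List.perm_iff_count]
    intro a
    simp [List.count_append, count_wordOf]
  have hkl : (fun a => (((k + l) a : ℕ) : ℤ)) = (fun a => (k a : ℤ)) + fun a => (l a : ℤ) := by
    funext a
    simp
  have h2 : (N.exec (wordOf k) (fun a => (k a : ℤ), q)).2 = q := localAct_snd hq hk
  unfold localAct
  rw [N.exec_perm hp, exec_append, hkl, exec_add, h2,
    add_comm (N.exec (wordOf k) (fun a => (k a : ℤ), q)).1, exec_add, add_comm]

theorem exists_extension {ι H : Type*} [AddCommGroup H] (K : AddSubgroup (ι → ℤ)) (n : ℕ)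
    (hn : 0 < n) (hK : ∀ x : ι → ℤ, n • x ∈ K) (f : (ι → ℕ) → H)
    (hf : ∀ k l : ι → ℕ, (fun i => (k i : ℤ)) ∈ K → (fun i => (l i : ℤ)) ∈ K →
      f (k + l) = f k + f l) :
    ∃ P : K →+ H, ∀ (k : ι → ℕ) (hk : (fun i => (k i : ℤ)) ∈ K), P ⟨_, hk⟩ = f k := by
  have hsplit : ∀ k : K, ∃ p m : ι → ℕ, (fun i => (p i : ℤ)) ∈ K ∧ (fun i => (m i : ℤ)) ∈ K ∧
      ∀ i, (k.1 i : ℤ) = p i - m i := by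
    intro k
    have hm : (fun i => ((n * (-(k.1 i)).toNat : ℕ) : ℤ)) ∈ K := by
      convert hK (fun i => ((-(k.1 i)).toNat : ℤ)) using 1
      funext i
      simp
    have hpos : ∀ i, (((k.1 i + (n * (-(k.1 i)).toNat : ℕ)).toNat : ℕ) : ℤ) =
        k.1 i + (n * (-(k.1 i)).toNat : ℕ) := by
      intro i
      apply Int.toNat_of_nonneg
      have h1 : (-(k.1 i)).toNat ≤ n * (-(k.1 i)).toNat := Nat.le_mul_of_pos_left _ hn
      have h2 : -(k.1 i) ≤ (-(k.1 i)).toNat := Int.self_le_toNat _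
      have h3 : ((-(k.1 i)).toNat : ℤ) ≤ (n * (-(k.1 i)).toNat : ℕ) := by exact_mod_cast h1
      linarith
    refine ⟨fun i => (k.1 i + (n * (-(k.1 i)).toNat : ℕ)).toNat,
      fun i => n * (-(k.1 i)).toNat, ?_, hm, ?_⟩
    · convert K.add_mem k.2 hm using 1
      funext i
      exact hpos i
    · intro i
      rw [hpos i]
      ring
  choose p m hp hm hkpm using hsplit
  have hwd : ∀ a b c d : ι → ℕ, (fun i => (a i : ℤ)) ∈ K → (fun i => (b i : ℤ)) ∈ K →
      (fun i => (c i : ℤ)) ∈ K → (fun i => (d i : ℤ)) ∈ K →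
      (∀ i, (a i : ℤ) - b i = c i - d i) → f a - f b = f c - f d := by
    intro a b c d ha hb hc hd h
    have h1 : a + d = c + b := by
      funext i
      have := h i
      simp only [Pi.add_apply]
      omega
    rw [sub_eq_sub_iff_add_eq_add, ← hf a d ha hd, h1, hf c b hc hb]
  have hadd : ∀ a b : ι → ℕ, (fun i => (a i : ℤ)) ∈ K → (fun i => (b i : ℤ)) ∈ K →
      (fun i => ((a + b) i : ℤ)) ∈ K := by
    intro a b ha hb
    convert K.add_mem ha hb using 1
    funext i
    simp
  have h00 : (fun i => (((0 : ι → ℕ) i : ℕ) : ℤ)) ∈ K := by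
    convert K.zero_mem using 1
    funext i
    simp
  have hf0 : f 0 = 0 := by
    have := hf 0 0 h00 h00
    rw [add_zero] at this
    exact left_eq_add.mp this
  refine ⟨AddMonoidHom.mk' (fun k => f (p k) - f (m k)) ?_, ?_⟩
  · intro k l
    have h1 : f (p k) - f (m k) + (f (p l) - f (m l)) = f (p k + p l) - f (m k + m l) := by
      rw [hf _ _ (hp k) (hp l), hf _ _ (hm k) (hm l)]
      abel
    rw [h1]
    refine hwd _ _ _ _ (hp _) (hm _) (hadd _ _ (hp k) (hp l)) (hadd _ _ (hm k) (hm l)) ?_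
    intro i
    have e1 := hkpm (k + l) i
    have e2 := hkpm k i
    have e3 := hkpm l i
    have e4 : (k + l).1 i = k.1 i + l.1 i := rfl
    simp only [Pi.add_apply]
    push_cast
    linarith
  · intro k hk
    change f (p ⟨_, hk⟩) - f (m ⟨_, hk⟩) = f k
    rw [hwd _ _ k 0 (hp _) (hm _) hk h00, hf0, sub_zero]
    intro i
    have := hkpm ⟨_, hk⟩ i
    simp only at this
    rw [← this]
    simp

theorem exists_productionMap {q : (v : V) → Q v} (hq : q ∈ N.locallyRecurrent) :
    ∃ P : N.totalKernel →+ ((Σ v, A v) → ℤ),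
      ∀ (k : (Σ v, A v) → ℕ) (hk : (fun a => (k a : ℤ)) ∈ N.totalKernel),
        N.localAct k q = (P ⟨_, hk⟩, q) := by
  obtain ⟨n, hn, hK⟩ := N.exists_smul_mem_totalKernel
  obtain ⟨P, hP⟩ := exists_extension N.totalKernel n hn hK (fun k => (N.localAct k q).1)
    (fun k l hk _ => localAct_add hq hk)
  exact ⟨P, fun k hk => Prod.ext (hP k hk).symm (localAct_snd hq hk)⟩

/-- The production map `P_q : K → ℤ^A` at a locally recurrent state `q`: the group homomorphism
with `k ▷ q = P_q(k).q` for all `k ∈ K ∩ ℕ^A`. (It is unique because `K` is generated by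
`K ∩ ℕ^A`.) -/
noncomputable def productionMap {q : (v : V) → Q v} (hq : q ∈ N.locallyRecurrent) :
    N.totalKernel →+ ((Σ v, A v) → ℤ) :=
  Classical.choose (exists_productionMap hq)

theorem productionMap_spec {q : (v : V) → Q v} (hq : q ∈ N.locallyRecurrent)
    (k : (Σ v, A v) → ℕ) (hk : (fun a => (k a : ℤ)) ∈ N.totalKernel) :
    N.localAct k q = (productionMap hq ⟨_, hk⟩, q) :=
  Classical.choose_spec (exists_productionMap hq) k hk

variable (N)

/-- The reset number `r_a = min {m ≥ 1 : m 1_a ∈ K}`. -/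
noncomputable def resetNumber (a : Σ v, A v) : ℕ :=
  sInf {m : ℕ | 1 ≤ m ∧ (m : ℤ) • (Pi.single a 1 : (Σ v, A v) → ℤ) ∈ N.totalKernel}

theorem resetNumber_spec (a : Σ v, A v) : 1 ≤ N.resetNumber a ∧
    (N.resetNumber a : ℤ) • (Pi.single a 1 : (Σ v, A v) → ℤ) ∈ N.totalKernel := by
  obtain ⟨n, hn, hK⟩ := N.exists_smul_mem_totalKernel
  refine Nat.sInf_mem (s := {m : ℕ | 1 ≤ m ∧
    (m : ℤ) • (Pi.single a 1 : (Σ v, A v) → ℤ) ∈ N.totalKernel}) ⟨n, hn, ?_⟩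
  rw [natCast_zsmul]
  exact hK _

/-- A network is rectangular if `K = ∏ r_a ℤ`. -/
def IsRectangular : Prop :=
  ∀ x : (Σ v, A v) → ℤ, x ∈ N.totalKernel ↔ ∀ a, (N.resetNumber a : ℤ) ∣ x a

variable {N}

/-- The production matrix: the rational matrix whose column `a` is `P(1_a) = (1/r_a) P(r_a 1_a)`,
that is, the matrix of the `ℚ`-linear extension of the production map `K → ℤ^A`. -/
noncomputable def productionMatrix {q : (v : V) → Q v} (hq : q ∈ N.locallyRecurrent) :
    Matrix (Σ v, A v) (Σ v, A v) ℚ :=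
  Matrix.of fun b a =>
    (1 / (N.resetNumber a : ℚ)) * (productionMap hq ⟨_, (N.resetNumber_spec a).2⟩ b : ℚ)

/-- The production matrix agrees with the production map on `K`. -/
theorem productionMatrix_mulVec {q : (v : V) → Q v} (hq : q ∈ N.locallyRecurrent)
    (k : N.totalKernel) :
    (productionMatrix hq).mulVec (fun a => (k.1 a : ℚ)) = fun b => (productionMap hq k b : ℚ) := by
  have hr : ∀ a, (N.resetNumber a : ℚ) ≠ 0 := fun a => by
    have := (N.resetNumber_spec a).1
    positivity
  obtain ⟨c, hc⟩ : ∃ c : (Σ v, A v) → ℤ,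
      ∀ a, (∏ a, (N.resetNumber a : ℤ)) = N.resetNumber a * c a :=
    ⟨_, fun a => Classical.choose_spec
      (Finset.dvd_prod_of_mem (fun a => (N.resetNumber a : ℤ)) (Finset.mem_univ a))⟩
  have hR : (∏ a, (N.resetNumber a : ℚ)) ≠ 0 := Finset.prod_ne_zero_iff.mpr fun a _ => hr a
  have hsum : (∏ a, (N.resetNumber a : ℤ)) • k =
      ∑ a, (c a * k.1 a) • (⟨_, (N.resetNumber_spec a).2⟩ : N.totalKernel) := by
    refine Subtype.ext ?_
    funext b
    simp only [AddSubgroup.coe_zsmul, AddSubgroup.val_finsetSum, Finset.sum_apply, Pi.smul_apply,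
      Pi.single_apply, smul_eq_mul]
    rw [Finset.sum_eq_single b]
    · rw [hc b]
      simp
      ring
    · intro a _ hab
      simp [hab.symm]
    · simp
  funext b
  have hP := congrFun (congrArg (productionMap hq) hsum) b
  rw [map_zsmul, map_sum] at hP
  simp only [map_zsmul, Pi.smul_apply, Finset.sum_apply, smul_eq_mul] at hP
  have hP' := congrArg (fun z : ℤ => (z : ℚ)) hP
  push_cast at hP'
  apply mul_left_cancel₀ hR
  rw [hP', Matrix.mulVec, dotProduct, Finset.mul_sum]
  refine Finset.sum_congr rfl fun a _ => ?_
  have hca : (∏ a, (N.resetNumber a : ℚ)) = N.resetNumber a * c a := by exact_mod_cast hc a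
  rw [hca]
  simp only [productionMatrix, Matrix.of_apply]
  have := hr a
  field_simp

/-- The Laplacian `L = (I - P) D`, where `D` is diagonal with entries `r_a`. -/
noncomputable def laplacian {q : (v : V) → Q v} (hq : q ∈ N.locallyRecurrent) :
    Matrix (Σ v, A v) (Σ v, A v) ℚ :=
  (1 - productionMatrix hq) * Matrix.diagonal fun a => (N.resetNumber a : ℚ)

/-- The subgroup `L ℤ^A` of `ℤ^A`. -/
noncomputable def laplacianImage {q : (v : V) → Q v} (hq : q ∈ N.locallyRecurrent) :
    AddSubgroup ((Σ v, A v) → ℤ) where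
  carrier := {x | ∃ y : (Σ v, A v) → ℤ,
    (fun a => (x a : ℚ)) = (laplacian hq).mulVec fun a => (y a : ℚ)}
  zero_mem' := ⟨0, by
    have h : (fun a : Σ v, A v => (((0 : (Σ v, A v) → ℤ) a : ℤ) : ℚ)) = 0 := by
      funext a
      simp
    rw [h, Matrix.mulVec_zero]⟩
  add_mem' := by
    rintro x x' ⟨y, hy⟩ ⟨y', hy'⟩
    refine ⟨y + y', ?_⟩
    have h : ∀ z z' : (Σ v, A v) → ℤ, (fun a => (((z + z') a : ℤ) : ℚ)) =
        (fun a => (z a : ℚ)) + fun a => (z' a : ℚ) := by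
      intro z z'
      funext a
      simp
    rw [h, h, Matrix.mulVec_add, hy, hy']
  neg_mem' := by
    rintro x ⟨y, hy⟩
    refine ⟨-y, ?_⟩
    have h : ∀ z : (Σ v, A v) → ℤ, (fun a => (((-z) a : ℤ) : ℚ)) = -fun a => (z a : ℚ) := by
      intro z
      funext a
      simp
    rw [h, h, Matrix.mulVec_neg, hy]

/-- `L` maps `ℤ^A` into `ℤ^A`. -/
theorem laplacian_mulVec_integral {q : (v : V) → Q v} (hq : q ∈ N.locallyRecurrent)
    (y : (Σ v, A v) → ℤ) : ∃ x : (Σ v, A v) → ℤ,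
      (fun a => (x a : ℚ)) = (laplacian hq).mulVec fun a => (y a : ℚ) := by
  have hk : (fun a => (N.resetNumber a : ℤ) * y a) ∈ N.totalKernel := by
    have h : (fun a => (N.resetNumber a : ℤ) * y a) =
        ∑ a, y a • ((N.resetNumber a : ℤ) • (Pi.single a 1 : (Σ v, A v) → ℤ)) := by
      funext b
      simp only [Finset.sum_apply, Pi.smul_apply, Pi.single_apply, smul_eq_mul]
      rw [Finset.sum_eq_single b]
      · simp
        ring
      · intro a _ hab
        simp [hab.symm]
      · simp
    rw [h]
    exact N.totalKernel.sum_mem fun a _ => N.totalKernel.zsmul_mem (N.resetNumber_spec a).2 _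
  refine ⟨fun a => N.resetNumber a * y a - productionMap hq ⟨_, hk⟩ a, ?_⟩
  have hd : (Matrix.diagonal fun a => (N.resetNumber a : ℚ)).mulVec (fun a => (y a : ℚ)) =
      fun a => (((N.resetNumber a : ℤ) * y a : ℤ) : ℚ) := by
    funext a
    simp [Matrix.mulVec_diagonal]
  have hp := productionMatrix_mulVec hq ⟨_, hk⟩
  rw [laplacian, ← Matrix.mulVec_mulVec, hd, Matrix.sub_mulVec, Matrix.one_mulVec, hp]
  funext a
  simp

end Laplacian

end Network

end AbelianNet

namespace AbelianNet

/-! The natural map is onto because every element of $M$ is the action $q \mapsto x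
\triangleright\!\triangleright q$ of some $x\in\mathbb N^A$. The heart of the proof is that its
kernel is exactly $(I-P)K$. The rest is bookkeeping: $D\mathbb Z^A=\prod_a r_a\mathbb Z$ lies in
$K$, so $L\mathbb Z^A=(I-P)D\mathbb Z^A$ lies in the kernel, and rectangularity says $D\mathbb
Z^A=K$.

$(I-P)K\subseteq\ker$ (`IsIrreducible.toCrit_productionMap`): a globally recurrent state $q$ is
locally recurrent, so for $k\in K\cap\mathbb N^A$ the letters $k$ can legally be processed from
$k.q$, which leads to $P(k).q$. Hence $k$ and $P(k)$ act alike on every recurrent state, which is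
equality in the critical group (`toCrit_eq_iff`). Irreducibility makes $P$ the same at all these
states (`IsIrreducible.productionMap_eq`).

$\ker\subseteq(I-P)K$ (`IsIrreducible.exists_eq_sub_productionMap`): write $x=x^+-x^-$ and fix a
recurrent state $q$. Complete legal words $w$ for $x^+.q$ and $u$ for $x^-.q$ end in one common
state with no letters left. Append to both a word $c$ that leads back to $q$ and makes the letter
counts of $uc$ lie in $K$. As $wc$ also fixes $q$, irreducibility puts its counts in $K$
(`Processor.IsIrreducible.mem_kernel`). The net effects of $wc$ and $uc$ on the waiting letters,
from $0.q$, differ by $-x$, and these effects are $P-I$ applied to the counts. -/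

/-! ### Finite commutative monoids, irreducible actions, and homomorphisms on $K$ -/

theorem toMinGroup_mul {M : Type*} [CommMonoid M] [Finite M] (m m' : M) :
    toMinGroup (m * m') = toMinGroup m * toMinGroup m' := by
  refine Subtype.ext ?_
  change minIdempotent M * (m * m') = (minIdempotent M * m) * (minIdempotent M * m')
  rw [mul_mul_mul_comm, minIdempotent_mul_self]

theorem toMinGroup_one {M : Type*} [CommMonoid M] [Finite M] :
    toMinGroup (1 : M) = 1 :=
  Subtype.ext (mul_one _)

theorem toMinGroup_val {M : Type*} [CommMonoid M] [Finite M] (g : MinGroup M) :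
    toMinGroup g.1 = g :=
  Subtype.ext g.minIdempotent_mul

/-- In an irreducible action, any recurrent element is reached from any other element. -/
theorem IsIrreducibleAction.exists_smul_eq {M X : Type*} [CommMonoid M] [Finite M]
    [MulAction M X] (h : IsIrreducibleAction M X) (x : X) {x' : X}
    (hx' : x' ∈ recurrentSet M X) : ∃ m : M, m • x = x' := by
  obtain ⟨m, m', hm⟩ := h.2 x x'
  obtain ⟨c, hc⟩ := exists_mul_eq_minIdempotent m'
  -- With $m'c=e$: $cmx=cm'x'=ex'=x'$.
  refine ⟨c * m, ?_⟩
  rw [mul_smul, hm, ← mul_smul, mul_comm, hc, minIdempotent_smul hx']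

/-- For an irreducible processor, an element of `ℤ^I` that fixes one recurrent state fixes all. -/
theorem Processor.IsIrreducible.mem_kernel {I Q U : Type*} {B : U → Type*} [Fintype I] [Finite Q]
    {p : Processor I Q B} (hp : p.IsIrreducible) {x : I → ℤ} {q : recurrentSet p.monoid Q}
    (h : (p.intAction x).toMul q = q) : x ∈ p.kernel := by
  rw [Processor.kernel, AddMonoidHom.mem_ker]
  refine Additive.toMul.injective (Equiv.ext fun q' => ?_)
  -- Irreducibility makes the commutative group act transitively on the recurrent states, so all
  -- stabilizers coincide: move $q$ to $q'$ by $m$ and commute $x$ past $m$.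
  obtain ⟨m, hm⟩ := IsIrreducibleAction.exists_smul_eq hp q.1 q'.2
  have hm' : toMinGroup m • q = q' := Subtype.ext ((toMinGroup_smul m q).trans hm)
  have h' : (naturalMap p.gen x).toMul • q = q := h
  change (naturalMap p.gen x).toMul • q' = q'
  rw [← hm', smul_smul, mul_comm, mul_smul, h']

/-- If a subgroup `K` of `ℤ^ι` contains a multiple of every vector, then a homomorphism on `K` is
determined by its values on `K ∩ ℕ^ι`. -/
theorem addMonoidHom_ext_nat {ι H : Type*} [AddCommGroup H] {K : AddSubgroup (ι → ℤ)} {n : ℕ}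
    (hn : 0 < n) (hK : ∀ x : ι → ℤ, n • x ∈ K) {f g : K →+ H}
    (h : ∀ (k : ι → ℕ) (hk : (fun i => (k i : ℤ)) ∈ K), f ⟨_, hk⟩ = g ⟨_, hk⟩) : f = g := by
  ext k
  -- Write $k=(k+n|k|)-n|k|$. Both terms lie in $K$, and $n\ge1$ makes the first one nonnegative.
  have hm : (fun i => ((n * (k.1 i).natAbs : ℕ) : ℤ)) ∈ K := by
    convert hK (fun i => ((k.1 i).natAbs : ℤ)) using 1
    funext i
    simp
  have hpos : ∀ i, (((k.1 i + (n * (k.1 i).natAbs : ℕ)).toNat : ℕ) : ℤ) =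
      k.1 i + (n * (k.1 i).natAbs : ℕ) := by
    intro i
    apply Int.toNat_of_nonneg
    have h1 : (k.1 i).natAbs ≤ n * (k.1 i).natAbs := Nat.le_mul_of_pos_left _ hn
    omega
  have hp : (fun i => (((k.1 i + (n * (k.1 i).natAbs : ℕ)).toNat : ℕ) : ℤ)) ∈ K := by
    convert K.add_mem k.2 hm using 1
    funext i
    exact hpos i
  have hsplit : k = (⟨_, hp⟩ : K) - ⟨_, hm⟩ := by
    refine Subtype.ext (funext fun i => ?_)
    have hi := hpos i
    change k.1 i = ((k.1 i + (n * (k.1 i).natAbs : ℕ)).toNat : ℤ) - (n * (k.1 i).natAbs : ℕ)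
    omega
  rw [hsplit, map_sub, map_sub, h _ hp, h _ hm]

namespace Network

/-! ### Words, legality and the global action -/

section Executions

variable {V : Type*} [DecidableEq V] {G : Digraph V} {A Q : V → Type*} [∀ v, DecidableEq (A v)]
  {N : Network G A Q}

/-- Messages only add letters, so the stock of $b$ falls by at most one each time $b$ is processed.
-/
theorem exec_fst_ge (w : List (Σ v, A v)) (s : ((Σ v, A v) → ℤ) × ((v : V) → Q v))
    (b : Σ v, A v) : s.1 b - w.count b ≤ (N.exec w s).1 b := by
  induction w generalizing s with
  | nil => simp [exec]
  | cons a w ih =>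
    rw [exec_cons]
    refine le_trans ?_ (ih (N.step a s))
    have hm : (0 : ℤ) ≤ N.message a.1 a.2 (s.2 a.1) b := Int.natCast_nonneg _
    by_cases hab : b = a
    · subst hab
      simp only [step, Pi.single_eq_same, List.count_cons_self]
      push_cast
      linarith
    · rw [List.count_cons_of_ne (Ne.symm hab)]
      have := N.step_fst_le hab s
      linarith

/-- The letters waiting after an execution from `x.q` are those after an execution from `0.q`,
plus `x`. -/
theorem exec_eq_zero_add (w : List (Σ v, A v)) (x : (Σ v, A v) → ℤ) (q : (v : V) → Q v) :
    N.exec w (x, q) = ((N.exec w (0, q)).1 + x, (N.exec w (0, q)).2) := by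
  rw [← exec_add, zero_add]

/-- If the initial stock already covers the whole word, no letter can run out, whatever the messages
are. -/
theorem legal_of_count_le (w : List (Σ v, A v)) (s : ((Σ v, A v) → ℤ) × ((v : V) → Q v))
    (h : ∀ b, (w.count b : ℤ) ≤ s.1 b) : N.Legal w s := by
  induction w generalizing s with
  | nil => trivial
  | cons a w ih =>
    refine ⟨?_, ih _ fun b => ?_⟩
    · have := h a
      rw [List.count_cons_self] at this
      push_cast at this
      linarith [Int.natCast_nonneg (w.count a)]
    · have := h b
      have h1 := exec_fst_ge (N := N) [a] s b
      rw [exec_cons] at h1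
      have h2 : (N.exec [] (N.step a s)).1 b = (N.step a s).1 b := rfl
      rw [h2] at h1
      have h3 : (a :: w).count b = [a].count b + w.count b := by
        rw [← List.count_append, List.singleton_append]
      rw [h3] at this
      push_cast at this
      linarith

/-- Every element of a local monoid is the effect of processing some word at that vertex. -/
theorem exists_word_of_mem_monoid (v : V) {m : Function.End (Q v)}
    (hm : m ∈ (N.proc v).monoid) :
    ∃ l : List (A v), ∀ s, (N.exec (l.map (Sigma.mk v)) s).2 v = m (s.2 v) := by
  induction hm using Submonoid.closure_induction with
  | mem m hm =>
    obtain ⟨a, rfl⟩ := hm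
    exact ⟨[a], fun s => by simp [exec, step]⟩
  | one => exact ⟨[], fun s => rfl⟩
  | mul m m' _ _ ih ih' =>
    obtain ⟨l, hl⟩ := ih
    obtain ⟨l', hl'⟩ := ih'
    -- The product $mm'$ applies $m'$ first, so its word comes first.
    refine ⟨l' ++ l, fun s => ?_⟩
    rw [List.map_append, exec_append, hl, hl']
    rfl

theorem globalAct_zero (hN : N.HaltsOnAllInputs) (q : (v : V) → Q v) : globalAct hN 0 q = q :=
  globalAct_eq hN 0 q [] trivial fun _ => le_rfl

/-- Legal executions do not change the final state. -/
theorem globalAct_of_legal (hN : N.HaltsOnAllInputs) (x y : (Σ v, A v) → ℕ)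
    (q q' : (v : V) → Q v) (w : List (Σ v, A v)) (h : N.Legal w (fun a => (x a : ℤ), q))
    (he : N.exec w (fun a => (x a : ℤ), q) = (fun a => (y a : ℤ), q')) :
    globalAct hN x q = globalAct hN y q' := by
  obtain ⟨u, hu, huc⟩ := hN y q'
  rw [globalAct_eq hN y q' u hu huc, ← he, ← exec_append]
  refine globalAct_eq hN x q (w ++ u) (N.legal_append _ _ _ h (by rw [he]; exact hu)) fun a => ?_
  rw [exec_append, he]
  exact huc a

/-- A legal execution from nonnegative input stays nonnegative, so completeness leaves exactly $0$.
Every input letter must then have been processed, which gives the bound on the counts. -/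
theorem exists_exec_eq_globalAct (hN : N.HaltsOnAllInputs) (x : (Σ v, A v) → ℕ)
    (q : (v : V) → Q v) : ∃ w : List (Σ v, A v), (∀ a, x a ≤ w.count a) ∧
      N.exec w (fun a => (x a : ℤ), q) = (0, globalAct hN x q) := by
  obtain ⟨w, hw, hwc⟩ := hN x q
  refine ⟨w, fun a => ?_, Prod.ext (funext fun a => ?_) (globalAct_eq hN x q w hw hwc).symm⟩
  · have h1 := exec_fst_ge (N := N) w (fun a => (x a : ℤ), q) a
    have h2 := hwc a
    simp only at h1
    omega
  · exact le_antisymm (hwc a) (N.exec_nonneg w _ (fun a => Int.natCast_nonneg _) hw a)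

theorem exists_globalAct_of_mem_globalMonoid (hN : N.HaltsOnAllInputs)
    {m : Function.End ((v : V) → Q v)} (hm : m ∈ globalMonoid hN) :
    ∃ x : (Σ v, A v) → ℕ, m = globalAct hN x := by
  induction hm using Submonoid.closure_induction with
  | mem m hm =>
    obtain ⟨a, rfl⟩ := hm
    exact ⟨Pi.single a 1, rfl⟩
  | one => exact ⟨0, funext fun q => (globalAct_zero hN q).symm⟩
  | mul m m' _ _ ih ih' =>
    obtain ⟨x, rfl⟩ := ih
    obtain ⟨x', rfl⟩ := ih'
    exact ⟨x' + x, funext fun q => (globalAct_add hN x' x q).symm⟩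

/-! ### The natural map and its surjectivity -/

variable [Fintype V] [∀ v, Fintype (A v)] [∀ v, Finite (Q v)]

/-- The natural map sends `x ∈ ℕ^A` to `e m`, where `m ∈ M` is the map `q ↦ x ▷▷ q`. -/
theorem exists_toCrit_eq (hN : N.HaltsOnAllInputs) (x : (Σ v, A v) → ℕ) :
    ∃ m : globalMonoid hN, m.1 = globalAct hN x ∧
      toCrit hN (fun a => (x a : ℤ)) = Additive.ofMul (toMinGroup m) := by
  have hzero : ∃ m : globalMonoid hN, m.1 = globalAct hN 0 ∧
      toCrit hN (fun a => ((0 : (Σ v, A v) → ℕ) a : ℤ)) = Additive.ofMul (toMinGroup m) := by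
    refine ⟨1, funext fun q => (globalAct_zero hN q).symm, ?_⟩
    have h0 : (fun a : Σ v, A v => (((0 : (Σ v, A v) → ℕ) a : ℕ) : ℤ)) = 0 := by
      funext a
      simp
    rw [h0, map_zero, toMinGroup_one]
    rfl
  -- The claim is additive in $x$, which reduces it to the unit vectors $1_a$.
  have hadd : ∀ y z : (Σ v, A v) → ℕ,
      (∃ m : globalMonoid hN, m.1 = globalAct hN y ∧
        toCrit hN (fun a => (y a : ℤ)) = Additive.ofMul (toMinGroup m)) →
      (∃ m : globalMonoid hN, m.1 = globalAct hN z ∧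
        toCrit hN (fun a => (z a : ℤ)) = Additive.ofMul (toMinGroup m)) →
      ∃ m : globalMonoid hN, m.1 = globalAct hN (y + z) ∧
        toCrit hN (fun a => ((y + z) a : ℤ)) = Additive.ofMul (toMinGroup m) := by
    rintro y z ⟨m, hm, hm'⟩ ⟨l, hl, hl'⟩
    refine ⟨l * m, funext fun q => ?_, ?_⟩
    · rw [globalAct_add, ← hm, ← hl]
      rfl
    · have h : (fun a => (((y + z) a : ℕ) : ℤ)) = (fun a => (y a : ℤ)) + fun a => (z a : ℤ) := by
        funext a
        simp
      rw [h, map_add, hm', hl', ← ofMul_mul, ← toMinGroup_mul, mul_comm]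
  rw [← Finset.univ_sum_single x]
  refine Finset.sum_induction (fun a => Pi.single a (x a)) (fun y : (Σ v, A v) → ℕ =>
    ∃ m : globalMonoid hN, m.1 = globalAct hN y ∧
      toCrit hN (fun a => (y a : ℤ)) = Additive.ofMul (toMinGroup m)) hadd hzero fun a _ => ?_
  induction x a with
  | zero =>
    rw [Pi.single_zero]
    exact hzero
  | succ n ih =>
    rw [Pi.single_add]
    refine hadd _ _ ih ⟨⟨tau hN a, Submonoid.subset_closure ⟨a, rfl⟩⟩, rfl, ?_⟩
    have h1 : (fun b => ((Pi.single a 1 : (Σ v, A v) → ℕ) b : ℤ)) = Pi.single a 1 := by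
      funext b
      by_cases hb : b = a
      · subst hb
        simp
      · simp [hb]
    rw [h1]
    exact naturalMap_single _ a

theorem toCrit_surjective (hN : N.HaltsOnAllInputs) : Function.Surjective (toCrit hN) := by
  intro g
  obtain ⟨x, hx⟩ := exists_globalAct_of_mem_globalMonoid hN g.toMul.1.2
  obtain ⟨m, hm, hxm⟩ := exists_toCrit_eq hN x
  refine ⟨fun a => (x a : ℤ), ?_⟩
  have h : m = g.toMul.1 := Subtype.ext (hm.trans hx.symm)
  rw [hxm, h, toMinGroup_val]
  rfl

/-- Two vectors in `ℕ^A` have the same image in the critical group if and only if they act in the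
same way on the recurrent states. -/
theorem toCrit_eq_iff (hN : N.HaltsOnAllInputs) (x y : (Σ v, A v) → ℕ) :
    toCrit hN (fun a => (x a : ℤ)) = toCrit hN (fun a => (y a : ℤ)) ↔
      ∀ q ∈ recurrentSet (globalMonoid hN) ((v : V) → Q v), globalAct hN x q = globalAct hN y q := by
  obtain ⟨m, hm, hxm⟩ := exists_toCrit_eq hN x
  obtain ⟨l, hl, hyl⟩ := exists_toCrit_eq hN y
  rw [hxm, hyl, Additive.ofMul.injective.eq_iff]
  constructor
  · intro h q hq
    have h1 := toMinGroup_smul m ⟨q, hq⟩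
    rw [h, toMinGroup_smul] at h1
    rw [← hm, ← hl]
    exact h1.symm
  · intro h
    refine Subtype.ext ?_
    change minIdempotent _ * m = minIdempotent _ * l
    -- With $e$ applied first, equality of $me$ and $le$ as maps only concerns the image of $e$, the
    -- recurrent states.
    rw [mul_comm, mul_comm _ l]
    refine Subtype.ext (funext fun q => ?_)
    have := h (minIdempotent (globalMonoid hN) • q) ⟨q, rfl⟩
    rw [← hm, ← hl] at this
    exact this

end Executions

/-! ### Local recurrence and independence of the production map from the state -/

section Laplacian

variable {V : Type*} [Fintype V] [DecidableEq V] {G : Digraph V} {A Q : V → Type*}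
  [∀ v, Fintype (A v)] [∀ v, DecidableEq (A v)] [∀ v, Finite (Q v)] {N : Network G A Q}

/-- Recurrent states of the global monoid are locally recurrent. -/
theorem mem_locallyRecurrent_of_recurrent (hN : N.HaltsOnAllInputs) {q : (v : V) → Q v}
    (hq : q ∈ recurrentSet (globalMonoid hN) ((v : V) → Q v)) : q ∈ N.locallyRecurrent := by
  -- At each vertex $v$, a word `l v` that realizes $e_v$. Let $x$ count the letters of all these
  -- words. The action of $x$ divides $e$, so the recurrent state $q$ is
  -- $x\triangleright\!\triangleright(m'q)$ for some $m'$.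
  choose l hl using fun v =>
    exists_word_of_mem_monoid (N := N) v (minIdempotent (N.proc v).monoid).2
  obtain ⟨m, hm, -⟩ := exists_toCrit_eq hN (fun a : Σ v, A v => (l a.1).count a.2)
  obtain ⟨m', hm'⟩ := exists_mul_eq_minIdempotent m
  have hfix := minIdempotent_smul hq
  rw [← hm', mul_smul] at hfix
  have hglob : globalAct hN (fun a : Σ v, A v => (l a.1).count a.2) (m' • q) = q := by
    rw [← hm]
    exact hfix
  obtain ⟨w, hwc, hw⟩ :=
    exists_exec_eq_globalAct hN (fun a : Σ v, A v => (l a.1).count a.2) (m' • q)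
  rw [hglob] at hw
  intro v
  -- A complete execution uses every letter of $x$, so it contains `l v` up to order. By
  -- commutativity `l v` may be read last, which leaves the state at $v$ in $e_vQ_v$.
  have hperm : (((l v).map (Sigma.mk v)) ++ w.diff ((l v).map (Sigma.mk v))).Perm w := by
    refine List.subperm_append_diff_self_of_count_le fun a ha => ?_
    obtain ⟨b, -, rfl⟩ := List.mem_map.mp ha
    rw [List.count_map_of_injective _ _ sigma_mk_injective]
    exact hwc ⟨v, b⟩
  rw [← N.exec_perm (List.perm_append_comm.trans hperm), exec_append] at hw
  refine ⟨_, (hl v _).symm.trans (congrFun (congrArg Prod.snd hw) v)⟩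

/-- The state at $v$ feels only the letters of $A_v$. This lets words found separately at each
vertex be merged into one word. -/
theorem exec_snd_congr {q : (v : V) → Q v} (hq : q ∈ N.locallyRecurrent) (x y : (Σ v, A v) → ℤ)
    (w w' : List (Σ v, A v)) (v : V) (h : ∀ a : A v, w.count ⟨v, a⟩ = w'.count ⟨v, a⟩) :
    (N.exec w (x, q)).2 v = (N.exec w' (y, q)).2 v := by
  rw [exec_snd _ _ _ hq, exec_snd _ _ _ hq]
  simp only [h]

/-- In an irreducible network, any locally recurrent state can be turned into any other. -/
theorem IsIrreducible.exists_exec_eq (hirr : N.IsIrreducible) {q q' : (v : V) → Q v}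
    (hq : q ∈ N.locallyRecurrent) (hq' : q' ∈ N.locallyRecurrent) :
    ∃ w : List (Σ v, A v), ∀ x, (N.exec w (x, q)).2 = q' := by
  choose m hm using fun v => IsIrreducibleAction.exists_smul_eq (hirr v) (q v) (hq' v)
  choose l hl using fun v => exists_word_of_mem_monoid (N := N) v (m v).2
  refine ⟨wordOf fun a => (l a.1).count a.2, fun x => funext fun v => ?_⟩
  rw [← hm v]
  refine (exec_snd_congr hq x x _ ((l v).map (Sigma.mk v)) v fun a => ?_).trans (hl v (x, q))
  rw [count_wordOf, List.count_map_of_injective _ _ sigma_mk_injective]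

/-- Executing a word whose letter counts lie in `K`, from `0.q`. -/
theorem exec_zero_eq {q : (v : V) → Q v} (hq : q ∈ N.locallyRecurrent) (w : List (Σ v, A v))
    (hw : (fun a => (w.count a : ℤ)) ∈ N.totalKernel) :
    N.exec w (0, q) = (productionMap hq ⟨_, hw⟩ - fun a => (w.count a : ℤ), q) := by
  have hp : (wordOf fun a => w.count a).Perm w := by
    rw [List.perm_iff_count]
    exact fun a => count_wordOf _ a
  have h := productionMap_spec hq (fun a => w.count a) hw
  rw [localAct, N.exec_perm hp, exec_eq_zero_add, Prod.mk.injEq] at h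
  exact Prod.ext (eq_sub_of_add_eq h.1) h.2

/-- In an irreducible network, the production map does not depend on the locally recurrent
state. -/
theorem IsIrreducible.productionMap_eq (hirr : N.IsIrreducible) {q q' : (v : V) → Q v}
    (hq : q ∈ N.locallyRecurrent) (hq' : q' ∈ N.locallyRecurrent) :
    productionMap hq = productionMap hq' := by
  obtain ⟨n, hn, hK⟩ := N.exists_smul_mem_totalKernel
  refine addMonoidHom_ext_nat hn hK fun k hk => ?_
  obtain ⟨w, hw⟩ := hirr.exists_exec_eq hq hq'
  have hc : (fun a => ((wordOf k).count a : ℤ)) = fun a => (k a : ℤ) := by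
    funext a
    rw [count_wordOf]
  have hk' : (fun a => ((wordOf k).count a : ℤ)) ∈ N.totalKernel := by rwa [hc]
  -- Let $w$ lead from $q$ to $q'$. Processing $k$ before $w$ contributes $P_q(k)-k$, and processing
  -- it after $w$ contributes $P_{q'}(k)-k$. The contribution of $w$ is the same in both orders and
  -- cancels.
  have h1 : N.exec (wordOf k ++ w) (0, q) = N.exec (w ++ wordOf k) (0, q) :=
    N.exec_perm List.perm_append_comm _
  have h2 : N.exec w (0, q) = ((N.exec w (0, q)).1, q') := Prod.ext rfl (hw 0)
  rw [exec_append, exec_append, exec_zero_eq hq _ hk', h2, exec_eq_zero_add (wordOf k),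
    exec_zero_eq hq' _ hk', exec_eq_zero_add w, Prod.mk.injEq] at h1
  have h3 := h1.1
  rw [add_comm, add_left_inj, sub_left_inj] at h3
  simpa only [hc] using h3

/-! ### The kernel of the natural map -/

/-- The natural map sends `k` and `P(k)` to the same element of the critical group. -/
theorem IsIrreducible.toCrit_productionMap (hirr : N.IsIrreducible) (hN : N.HaltsOnAllInputs)
    {q : (v : V) → Q v} (hq : q ∈ N.locallyRecurrent) (k : N.totalKernel) :
    toCrit hN (productionMap hq k) = toCrit hN k.1 := by
  obtain ⟨n, hn, hK⟩ := N.exists_smul_mem_totalKernel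
  suffices h : (toCrit hN).comp (productionMap hq) = (toCrit hN).comp N.totalKernel.subtype from
    DFunLike.congr_fun h k
  refine addMonoidHom_ext_nat hn hK fun k hk => ?_
  change toCrit hN (productionMap hq ⟨_, hk⟩) = toCrit hN (fun a => (k a : ℤ))
  have hleg : ∀ q, N.Legal (wordOf k) (fun a => (k a : ℤ), q) := fun q =>
    legal_of_count_le _ _ fun a => by rw [count_wordOf]
  -- A legal execution cannot create debt, so $P(k)\in\mathbb N^A$ and it too acts globally.
  have hnn : ∀ a, 0 ≤ productionMap hq ⟨_, hk⟩ a := by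
    intro a
    have h := N.exec_nonneg _ _ (fun a => Int.natCast_nonneg _) (hleg q) a
    have h' := productionMap_spec hq k hk
    rw [localAct] at h'
    rwa [h'] at h
  have hcast : productionMap hq ⟨_, hk⟩ = fun a => ((productionMap hq ⟨_, hk⟩ a).toNat : ℤ) :=
    funext fun a => (Int.toNat_of_nonneg (hnn a)).symm
  rw [hcast, toCrit_eq_iff]
  intro q' hq'
  have hloc := mem_locallyRecurrent_of_recurrent hN hq'
  refine (globalAct_of_legal hN k _ q' q' (wordOf k) (hleg q') ?_).symm
  rw [← hcast, hirr.productionMap_eq hq hloc]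
  exact productionMap_spec hloc k hk

/-- Every element of the kernel of the natural map is of the form `k - P(k)` with `k ∈ K`. -/
theorem IsIrreducible.exists_eq_sub_productionMap (hirr : N.IsIrreducible)
    (hN : N.HaltsOnAllInputs) {q : (v : V) → Q v} (hq : q ∈ N.locallyRecurrent)
    {x : (Σ v, A v) → ℤ} (hx : toCrit hN x = 0) :
    ∃ k : N.totalKernel, x = k.1 - productionMap hq k := by
  obtain ⟨q', hq'⟩ : (recurrentSet (globalMonoid hN) ((v : V) → Q v)).Nonempty :=
    ⟨_, q, rfl⟩
  have hloc := mem_locallyRecurrent_of_recurrent hN hq'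
  rw [hirr.productionMap_eq hq hloc]
  have hsplit : x = (fun a => ((x a).toNat : ℤ)) - fun a => ((-x a).toNat : ℤ) :=
    funext fun a => (Int.toNat_sub_toNat_neg (x a)).symm
  rw [hsplit, map_sub, sub_eq_zero, toCrit_eq_iff] at hx
  have hfin := hx q' hq'
  obtain ⟨w, -, hw⟩ := exists_exec_eq_globalAct hN (fun a => (x a).toNat) q'
  obtain ⟨u, -, hu⟩ := exists_exec_eq_globalAct hN (fun a => (-x a).toNat) q'
  rw [hfin] at hw
  obtain ⟨n, hn, hK⟩ := N.exists_smul_mem_totalKernel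
  -- The word $c$ tops up each letter count of $u$ to $n$ times its value, so the counts of $uc$ lie
  -- in $K$.
  have hku : (fun a => ((u ++ wordOf fun a => (n - 1) * u.count a).count a : ℤ)) ∈
      N.totalKernel := by
    convert hK (fun a => (u.count a : ℤ)) using 1
    funext a
    obtain ⟨n, rfl⟩ := Nat.exists_eq_succ_of_ne_zero hn.ne'
    simp [List.count_append, count_wordOf]
    ring
  generalize (wordOf fun a => (n - 1) * u.count a) = c at hku
  rw [exec_eq_zero_add, Prod.mk.injEq] at hw hu
  -- The words $w$ and $u$ end in the same state, so $c$ has the same effect after either of them: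
  -- it returns to $q'$ and adds the same vector.
  have hec : ∀ y, N.exec c (y, (N.exec w (0, q')).2) =
      ((N.exec c (0, (N.exec u (0, q')).2)).1 + y, q') := by
    intro y
    rw [exec_eq_zero_add, hw.2, ← hu.2]
    refine Prod.ext rfl ?_
    have h := congrArg Prod.snd (exec_zero_eq hloc _ hku)
    rw [exec_append, ← Prod.mk.eta (p := N.exec u (0, q')), exec_eq_zero_add] at h
    exact h
  have hkw : (fun a => ((w ++ c).count a : ℤ)) ∈ N.totalKernel := by
    intro v
    refine (hirr v).mem_kernel (q := ⟨q' v, hloc v⟩) (Subtype.ext ?_)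
    rw [← exec_snd (w ++ c) 0 q' hloc v, exec_append, ← Prod.mk.eta (p := N.exec w (0, q')), hec]
  -- From $0.q'$, the words $u$ and $w$ leave $-x^-$ and $-x^+$, and $c$ then adds a common vector
  -- $d$. So $P(k_u)-k_u=d-x^-$ and $P(k_w)-k_w=d-x^+$, where $k_u,k_w$ count the letters of $uc$
  -- and $wc$. Subtracting gives $x$.
  refine ⟨⟨_, hkw⟩ - ⟨_, hku⟩, ?_⟩
  have h1 := congrArg Prod.fst (exec_zero_eq hloc _ hku)
  have h2 := congrArg Prod.fst (exec_zero_eq hloc _ hkw)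
  rw [exec_append, ← Prod.mk.eta (p := N.exec u (0, q')), exec_eq_zero_add] at h1
  rw [exec_append, ← Prod.mk.eta (p := N.exec w (0, q')), hec] at h2
  rw [map_sub]
  have h3 := hw.1
  have h4 := hu.1
  funext a
  have e1 := congrFun h1 a
  have e2 := congrFun h2 a
  have e3 := congrFun h3 a
  have e4 := congrFun h4 a
  have e5 := congrFun hsplit a
  simp only [Pi.add_apply, Pi.sub_apply, Pi.zero_apply] at e1 e2 e3 e4 e5
  change x a = (_ - _) - (_ - _)
  linarith

/-! ### The Laplacian image inside the kernel -/

/-- `L y = k - P(k)` for `k = D y`. -/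
theorem laplacian_mulVec {q : (v : V) → Q v} (hq : q ∈ N.locallyRecurrent)
    (y : (Σ v, A v) → ℤ) (hk : (fun a => (N.resetNumber a : ℤ) * y a) ∈ N.totalKernel) :
    (laplacian hq).mulVec (fun a => (y a : ℚ)) =
      fun a => ((N.resetNumber a * y a - productionMap hq ⟨_, hk⟩ a : ℤ) : ℚ) := by
  have hd : (Matrix.diagonal fun a => (N.resetNumber a : ℚ)).mulVec (fun a => (y a : ℚ)) =
      fun a => (((N.resetNumber a : ℤ) * y a : ℤ) : ℚ) := by
    funext a
    simp [Matrix.mulVec_diagonal]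
  have hp := productionMatrix_mulVec hq ⟨_, hk⟩
  rw [laplacian, ← Matrix.mulVec_mulVec, hd, Matrix.sub_mulVec, Matrix.one_mulVec, hp]
  funext a
  simp

theorem resetNumber_mul_mem_totalKernel (y : (Σ v, A v) → ℤ) :
    (fun a => (N.resetNumber a : ℤ) * y a) ∈ N.totalKernel := by
  have h : (fun a => (N.resetNumber a : ℤ) * y a) =
      ∑ a, y a • ((N.resetNumber a : ℤ) • (Pi.single a 1 : (Σ v, A v) → ℤ)) := by
    funext b
    simp only [Finset.sum_apply, Pi.smul_apply, Pi.single_apply, smul_eq_mul]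
    rw [Finset.sum_eq_single b]
    · simp
      ring
    · intro a _ hab
      simp [hab.symm]
    · simp
  rw [h]
  exact N.totalKernel.sum_mem fun a _ => N.totalKernel.zsmul_mem (N.resetNumber_spec a).2 _

/-- Since $Dy\in K$, the rational matrix product $Ly=(I-P)(Dy)$ can be evaluated by the integral map
$P$ on $K$. The lemma removes $\mathbb Q$ from the argument. -/
theorem mem_laplacianImage_iff {q : (v : V) → Q v} (hq : q ∈ N.locallyRecurrent)
    (x : (Σ v, A v) → ℤ) : x ∈ laplacianImage hq ↔ ∃ y : (Σ v, A v) → ℤ,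
      x = (fun a => (N.resetNumber a : ℤ) * y a) -
        productionMap hq ⟨_, resetNumber_mul_mem_totalKernel y⟩ := by
  refine exists_congr fun y => ?_
  rw [laplacian_mulVec hq y (resetNumber_mul_mem_totalKernel y), funext_iff, funext_iff]
  refine forall_congr' fun a => ?_
  rw [Int.cast_inj]
  rfl

theorem IsIrreducible.laplacianImage_le_ker (hirr : N.IsIrreducible) (hN : N.HaltsOnAllInputs)
    {q : (v : V) → Q v} (hq : q ∈ N.locallyRecurrent) :
    laplacianImage hq ≤ (toCrit hN).ker := by
  intro x hx
  obtain ⟨y, rfl⟩ := (mem_laplacianImage_iff hq x).mp hx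
  rw [AddMonoidHom.mem_ker, map_sub, hirr.toCrit_productionMap hN, sub_self]

/-- Rectangularity says that every $k\in K$ has the form $Dy$, so $(I-P)K$ is no larger than
$L\mathbb Z^A$. -/
theorem IsIrreducible.ker_le_laplacianImage (hirr : N.IsIrreducible) (hN : N.HaltsOnAllInputs)
    {q : (v : V) → Q v} (hq : q ∈ N.locallyRecurrent) (hrect : N.IsRectangular) :
    (toCrit hN).ker ≤ laplacianImage hq := by
  intro x hx
  obtain ⟨⟨k, hk⟩, rfl⟩ := hirr.exists_eq_sub_productionMap hN hq hx
  choose y hy using (hrect k).mp hk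
  obtain rfl : k = fun a => (N.resetNumber a : ℤ) * y a := funext hy
  exact (mem_laplacianImage_iff hq _).mpr ⟨y, rfl⟩

end Laplacian

end Network

end AbelianNet

theorem corollary3p14 {V : Type*} [Fintype V] [DecidableEq V] {G : Digraph V} {A Q : V → Type*}
    [∀ v, Fintype (A v)] [∀ v, DecidableEq (A v)] [∀ v, Finite (Q v)]
    (N : AbelianNet.Network G A Q) (hirr : N.IsIrreducible) (hN : N.HaltsOnAllInputs)
    (q : (v : V) → Q v) (hq : q ∈ N.locallyRecurrent) :
    ∃ φ : ((Σ v, A v) → ℤ) ⧸ AbelianNet.Network.laplacianImage hq →+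
        Additive (AbelianNet.Network.Crit hN),
      (∀ x : (Σ v, A v) → ℤ, φ (QuotientAddGroup.mk x) = AbelianNet.Network.toCrit hN x) ∧
      Function.Surjective φ ∧
      (N.IsRectangular → Function.Bijective φ) := by
  have hsurj : Function.Surjective (QuotientAddGroup.lift (AbelianNet.Network.laplacianImage hq)
      (AbelianNet.Network.toCrit hN) (hirr.laplacianImage_le_ker hN hq)) :=
    QuotientAddGroup.lift_surjective_of_surjective _ _
      (AbelianNet.Network.toCrit_surjective hN) _
  refine ⟨_, fun x => rfl, hsurj, fun hrect => ⟨?_, hsurj⟩⟩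
  rw [injective_iff_map_eq_zero]
  intro z hz
  obtain ⟨x, rfl⟩ := QuotientAddGroup.mk_surjective z
  exact (QuotientAddGroup.eq_zero_iff x).mpr (hirr.ker_le_laplacianImage hN hq hrect hz)
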